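/- Proposition. Let $k \geq 2$ be an integer and let $G = PSL(2, 2^k)$ be the projective special linear group of degree $2$ over the finite field with $2^k$ elements, i.e. the quotient of $SL(2, 2^k)$ by its center. Let $\mathcal{A}_G$ be the non-commuting graph of $G$: its vertex set is $G \setminus Z(G)$, where $Z(G)$ is the center of $G$, and two vertices $x, y$ are adjacent if and only if $xy \neq yx$. For a finite simple graph $\mathcal{G}$ with vertex set $v(\mathcal{G})$ and edge set $e(\mathcal{G})$, let $L(\mathcal{G}) = D(\mathcal{G}) - A(\mathcal{G})$ be its Laplacian matrix (degree matrix minus adjacency matrix), and let its Laplacian energy be $$LE(\mathcal{G}) = \sum_{\mu} \left|\mu - \frac{2|e(\mathcal{G})|}{|v(\mathcal{G})|}\right|,$$ where $\mu$ runs over the eigenvalues of $L(\mathcal{G})$, counted with multiplicity. Then $$LE(\mathcal{A}_G) = \frac{3\cdot 2^{6k} - 2\cdot 2^{5k} - 7\cdot 2^{4k} + 2^{3k} + 4\cdot 2^{2k} + 2^k}{2^{3k} - 2^k - 1}.$$ -/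

import Mathlib

/-- The non-commuting graph of a group `G`: its vertices are the non-central elements of `G`, and
two of them are adjacent if and only if they do not commute. -/
def nonCommutingGraph (G : Type*) [Group G] : SimpleGraph {x : G // x ∉ Subgroup.center G} where
  Adj x y := (x : G) * (y : G) ≠ (y : G) * (x : G)
  symm := ⟨fun _ _ h => Ne.symm h⟩
  loopless := ⟨fun _ h => h rfl⟩

open Classical in
/-- The Laplacian energy of a finite graph `Γ`: the sum of `|μ - 2 e / v|` over the eigenvalues `μ`,
counted with multiplicity, of the Laplacian matrix (degree matrix minus adjacency matrix), where
`v` and `e` are the numbers of vertices and of edges of `Γ`. -/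
noncomputable def laplacianEnergy {V : Type*} [Finite V] (Γ : SimpleGraph V) : ℝ :=
  letI : Fintype V := Fintype.ofFinite V
  ∑ i : V, |(Γ.isHermitian_lapMatrix ℝ).eigenvalues i -
    2 * (Γ.edgeFinset.card : ℝ) / (Fintype.card V : ℝ)|

/-!
Let `q = 2 ^ k`. In characteristic two the center of `SL(2, q)` is trivial, so `PSL(2, q)` is
`SL(2, q)`. The centralizer of an element `A ≠ 1` is its intersection with the commutative algebra
spanned by `1` and `A`; hence commuting is a transitive relation on the elements other than `1`, and
the non-commuting graph is complete multipartite, its parts being the centralizers without `1`.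

The Laplacian matrix of a complete multipartite graph on `n` vertices is a combination of diagonal
matrices constant on the parts, the projection `K` onto the functions constant on the parts, and the
all-ones matrix `J`. These satisfy relations that give all powers of the Laplacian
(`pow_eq_of_proj_relations`), so the power sums of its eigenvalues are known traces, and
power sums determine the sum of any function over the eigenvalues
(`sum_eq_sum_of_forall_sum_pow_eq`). The outcome,
`SimpleGraph.IsCompleteMultipartite.sum_eigenvalues_lapMatrix`, expresses the Laplacian energy by
sums over the vertices of functions of the part size.

It remains to count the elements of `SL(2, q)` with a given centralizer order. The centralizer of
`A ≠ 1` has as many elements as the conic `a ^ 2 + t a b + b ^ 2 = 1` has points, `t` being the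
trace of `A`. Let `r` be the number of roots of `u ^ 2 + t u + 1`. Projecting the conic from `(1, 0)`
shows that it has `q + 1 - r` points if `t ≠ 0`; for `t = 0` it is a double line with `q` points,
and `r = 1`, so that the formula holds again. The elements of trace `t` number `q (q - 1 + r)`; moreover `r = 1` for `t = 0`
and `r ∈ {0, 2}` for `t ≠ 0`, and the sum of `r` over all `t` is `q - 1`. This determines the
distribution of the centralizer orders (`Matrix.SpecialLinearGroup.sum_natCard_centralizer`): order
`q` occurs `q ^ 2 - 1` times, order `q - 1` occurs `q (q + 1) (q - 2) / 2` times, and order `q + 1`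
occurs `q ^ 2 (q - 1) / 2` times.
-/

/-! ### Power sums, eigenvalues and matrix powers -/

/-- A finite family of points and a finite family of weighted points with the same power sums give
the same sum to every function, since a function on finitely many points is a polynomial there. -/
theorem sum_eq_sum_of_forall_sum_pow_eq {K ι κ : Type*} [Field K] [Fintype ι] [Fintype κ]
    (a : ι → K) (b w : κ → K) (h : ∀ k : ℕ, ∑ i, a i ^ k = ∑ j, w j * b j ^ k) (f : K → K) :
    ∑ i, f (a i) = ∑ j, w j * f (b j) := by
  classical
  have hp : ∀ p : Polynomial K, ∑ i, p.eval (a i) = ∑ j, w j * p.eval (b j) := by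
    intro p
    simp_rw [Polynomial.eval_eq_sum_range, Finset.mul_sum]
    rw [Finset.sum_comm, Finset.sum_comm (s := Finset.univ (α := κ))]
    refine Finset.sum_congr rfl fun k _ => ?_
    rw [← Finset.mul_sum, h, Finset.mul_sum]
    exact Finset.sum_congr rfl fun j _ => by ring
  let s : Finset K := Finset.univ.image a ∪ Finset.univ.image b
  have hs : ∀ x ∈ s, (Lagrange.interpolate s id f).eval x = f x := fun x hx =>
    Lagrange.eval_interpolate_at_node (v := id) f Function.injective_id.injOn hx
  have h1 : ∀ i, a i ∈ s := fun i => by simp [s]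
  have h2 : ∀ j, b j ∈ s := fun j => by simp [s]
  simpa only [hs _ (h1 _), hs _ (h2 _)] using hp (Lagrange.interpolate s id f)

theorem Matrix.IsHermitian.trace_pow_eq_sum_eigenvalues_pow {n : Type*} [Fintype n]
    [DecidableEq n] {A : Matrix n n ℝ} (hA : A.IsHermitian) (k : ℕ) :
    (A ^ k).trace = ∑ i, hA.eigenvalues i ^ k := by
  conv_lhs => rw [hA.spectral_theorem, ← map_pow, Unitary.conjStarAlgAut_apply,
    Matrix.trace_mul_comm, ← mul_assoc]
  simp [Matrix.diagonal_pow, Matrix.trace_diagonal]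

/-- The powers of `D (1 - K) + n K - J`, from the relations that hold between the projection `K`
onto the functions constant on the parts, the all-ones matrix `J` and a diagonal matrix `D` that is
constant on the parts. As `n⁻¹ J` is a projection onto a part of the range of `K`, the elements
`1 - K`, `K - n⁻¹ J` and `n⁻¹ J` are orthogonal idempotents with sum `1`, on which the element acts
as `D`, `n` and `0`. -/
theorem pow_eq_of_proj_relations {R : Type*} [Ring R] [Algebra ℝ R] {n : ℝ} (hn : n ≠ 0)
    {D K J : R} (hKK : K * K = K) (hKJ : K * J = J) (hJK : J * K = J) (hJJ : J * J = n • J)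
    (hDK : D * K = K * D) (k : ℕ) :
    (D * (1 - K) + n • K - J) ^ k =
      D ^ k * (1 - K) + n ^ k • (K - n⁻¹ • J) + (0 : ℝ) ^ k • (n⁻¹ • J) := by
  have hK1 : K * (D * (1 - K)) = 0 := by
    rw [← mul_assoc, ← hDK, mul_assoc, mul_sub, mul_one, hKK, sub_self, mul_zero]
  have hJ1 : J * (D * (1 - K)) = 0 := by rw [← hJK, mul_assoc, hK1, mul_zero]
  have e1 : (1 - K) * (D * (1 - K) + n • K - J) = D * (1 - K) := by
    rw [sub_mul, one_mul, mul_sub K, mul_add K, hK1, mul_smul_comm, hKK, hKJ]; abel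
  have e3 : J * (D * (1 - K) + n • K - J) = 0 := by
    rw [mul_sub, mul_add, hJ1, mul_smul_comm, hJK, hJJ, zero_add, sub_self]
  have e2 : (K - n⁻¹ • J) * (D * (1 - K) + n • K - J) = n • (K - n⁻¹ • J) := by
    rw [sub_mul, smul_mul_assoc, e3, mul_sub, mul_add, hK1, mul_smul_comm, hKK, hKJ, smul_sub,
      smul_smul, mul_inv_cancel₀ hn, one_smul, smul_zero, sub_zero, zero_add]
  induction k with
  | zero => simp
  | succ k ih =>
    rw [pow_succ, ih, add_mul, add_mul, mul_assoc, e1, smul_mul_assoc, e2, smul_mul_assoc,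
      smul_mul_assoc, e3, smul_zero, smul_zero, smul_smul, ← mul_assoc, ← pow_succ, ← pow_succ,
      zero_pow k.succ_ne_zero, zero_smul]

/-! ### The Laplacian spectrum of a complete multipartite graph -/

namespace SimpleGraph

variable {V : Type*} {Γ : SimpleGraph V}

theorem IsCompleteMultipartite.adj_congr (h : Γ.IsCompleteMultipartite) {x y : V}
    (hxy : ¬ Γ.Adj x y) (z : V) : Γ.Adj x z ↔ Γ.Adj y z := by
  rw [← not_iff_not]
  exact ⟨h.trans _ _ _ fun h' => hxy h'.symm, h.trans _ _ _ hxy⟩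

variable [Fintype V] [DecidableRel Γ.Adj] (Γ)

/-- The number of vertices not adjacent to `x`, with `x` itself counted. In a complete multipartite
graph this is the size of the part of `x`. -/
def partSize (x : V) : ℕ := (Finset.univ.filter fun y => ¬ Γ.Adj x y).card

/-- For a complete multipartite graph, the matrix of the orthogonal projection onto the functions
that are constant on the parts. -/
noncomputable def partProj : Matrix V V ℝ :=
  Matrix.of fun x y => if Γ.Adj x y then 0 else ((Γ.partSize x : ℝ))⁻¹

theorem degree_add_partSize (x : V) : Γ.degree x + Γ.partSize x = Fintype.card V := by
  rw [partSize, ← card_neighborFinset_eq_degree, neighborFinset_eq_filter,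
    Finset.card_filter_add_card_filter_not, Finset.card_univ]

theorem partSize_pos (x : V) : 0 < Γ.partSize x :=
  Finset.card_pos.mpr ⟨x, by simp⟩

variable {Γ}

theorem IsCompleteMultipartite.partSize_congr (h : Γ.IsCompleteMultipartite) {x y : V}
    (hxy : ¬ Γ.Adj x y) : Γ.partSize x = Γ.partSize y := by
  simp only [partSize, h.adj_congr hxy]

theorem sum_partProj (x : V) : ∑ y, Γ.partProj x y = 1 := by
  have h0 : (Γ.partSize x : ℝ) ≠ 0 := by exact_mod_cast (Γ.partSize_pos x).ne'
  simp only [partProj, Matrix.of_apply]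
  rw [Finset.sum_ite, Finset.sum_const_zero, zero_add, Finset.sum_const, nsmul_eq_mul]
  exact mul_inv_cancel₀ h0

theorem IsCompleteMultipartite.partProj_comm (h : Γ.IsCompleteMultipartite) (x y : V) :
    Γ.partProj x y = Γ.partProj y x := by
  simp only [partProj, Matrix.of_apply, Γ.adj_comm x y]
  split_ifs with hyx
  · rfl
  · rw [h.partSize_congr hyx]

theorem IsCompleteMultipartite.partProj_mul_self (h : Γ.IsCompleteMultipartite) :
    Γ.partProj * Γ.partProj = Γ.partProj := by
  ext x z
  rw [Matrix.mul_apply]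
  have key : ∀ y, Γ.partProj x y * Γ.partProj y z = Γ.partProj x y * Γ.partProj x z := by
    intro y
    by_cases hxy : Γ.Adj x y
    · simp [partProj, hxy]
    · simp only [partProj, Matrix.of_apply, h.adj_congr hxy z, h.partSize_congr hxy]
  simp_rw [key]
  rw [← Finset.sum_mul, sum_partProj, one_mul]

theorem partProj_mul_ones :
    Γ.partProj * Matrix.of (fun _ _ => (1 : ℝ)) = Matrix.of fun _ _ => (1 : ℝ) := by
  ext x z
  simp [Matrix.mul_apply, sum_partProj]

theorem IsCompleteMultipartite.ones_mul_partProj (h : Γ.IsCompleteMultipartite) :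
    Matrix.of (fun _ _ => (1 : ℝ)) * Γ.partProj = Matrix.of fun _ _ => (1 : ℝ) := by
  ext x z
  simp only [Matrix.mul_apply, Matrix.of_apply, one_mul]
  simp_rw [h.partProj_comm _ z]
  exact sum_partProj z

theorem IsCompleteMultipartite.diagonal_mul_partProj [DecidableEq V] (h : Γ.IsCompleteMultipartite)
    (g : ℕ → ℝ) :
    Matrix.diagonal (fun x => g (Γ.partSize x)) * Γ.partProj =
      Γ.partProj * Matrix.diagonal fun x => g (Γ.partSize x) := by
  ext x y
  rw [Matrix.diagonal_mul, Matrix.mul_diagonal]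
  by_cases hxy : Γ.Adj x y
  · simp [partProj, hxy]
  · rw [h.partSize_congr hxy, mul_comm]

variable [DecidableEq V]

theorem lapMatrix_eq_partProj : Γ.lapMatrix ℝ =
    Matrix.diagonal (fun x => (Fintype.card V : ℝ) - Γ.partSize x) * (1 - Γ.partProj) +
      (Fintype.card V : ℝ) • Γ.partProj - Matrix.of fun _ _ => (1 : ℝ) := by
  ext x y
  have h0 : (Γ.partSize x : ℝ) ≠ 0 := by exact_mod_cast (Γ.partSize_pos x).ne'
  have hd : (Fintype.card V : ℝ) = Γ.degree x + Γ.partSize x := by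
    exact_mod_cast (Γ.degree_add_partSize x).symm
  simp only [lapMatrix, degMatrix, Matrix.sub_apply, Matrix.add_apply, Matrix.diagonal_mul,
    Matrix.smul_apply, Matrix.of_apply, smul_eq_mul, adjMatrix_apply, partProj, hd]
  rcases eq_or_ne x y with rfl | hxy
  · simp only [Matrix.diagonal_apply_eq, Matrix.one_apply_eq, Γ.irrefl, if_false]
    field_simp
    ring
  · simp only [Matrix.diagonal_apply_ne _ hxy, Matrix.one_apply_ne hxy]
    split_ifs
    · ring
    · field_simp
      ring

theorem IsCompleteMultipartite.trace_lapMatrix_pow [Nonempty V] (h : Γ.IsCompleteMultipartite)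
    (k : ℕ) : (Γ.lapMatrix ℝ ^ k).trace =
      ∑ x, (1 - (Γ.partSize x : ℝ)⁻¹) * ((Fintype.card V : ℝ) - Γ.partSize x) ^ k +
        (∑ x, (Γ.partSize x : ℝ)⁻¹ - 1) * (Fintype.card V : ℝ) ^ k + 0 ^ k := by
  have hn : (Fintype.card V : ℝ) ≠ 0 := by exact_mod_cast Fintype.card_ne_zero
  rw [lapMatrix_eq_partProj, pow_eq_of_proj_relations hn h.partProj_mul_self partProj_mul_ones
    h.ones_mul_partProj _ (h.diagonal_mul_partProj fun m => (Fintype.card V : ℝ) - m)]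
  · have hd : ∀ x, Γ.partProj x x = (Γ.partSize x : ℝ)⁻¹ := fun x => by simp [partProj]
    simp [Matrix.trace, Matrix.diagonal_pow, Matrix.diagonal_mul, hd, Finset.sum_add_distrib,
      Finset.sum_sub_distrib, hn, mul_comm, ← Finset.mul_sum, mul_sub]
    rw [mul_comm _ (_ ^ k * _), mul_assoc, inv_mul_cancel₀ hn, mul_one]
  · ext x y
    simp [Matrix.mul_apply]

/-- The Laplacian spectrum of a complete multipartite graph with `n` vertices: every part of size
`m` gives the eigenvalue `n - m` with multiplicity `m - 1`, the eigenvalue `n` has as multiplicity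
the number of parts minus one, and `0` is simple. A sum over the parts is written as a sum over the
vertices with weight `1 / m`. -/
theorem IsCompleteMultipartite.sum_eigenvalues_lapMatrix [Nonempty V]
    (h : Γ.IsCompleteMultipartite) (f : ℝ → ℝ) :
    ∑ i, f ((Γ.isHermitian_lapMatrix ℝ).eigenvalues i) =
      ∑ x, (1 - (Γ.partSize x : ℝ)⁻¹) * f ((Fintype.card V : ℝ) - Γ.partSize x) +
        (∑ x, (Γ.partSize x : ℝ)⁻¹ - 1) * f (Fintype.card V : ℝ) + f 0 := by
  have := sum_eq_sum_of_forall_sum_pow_eq (κ := V ⊕ Bool)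
    ((Γ.isHermitian_lapMatrix ℝ).eigenvalues)
    (Sum.elim (fun x => (Fintype.card V : ℝ) - Γ.partSize x)
      fun t => bif t then (Fintype.card V : ℝ) else 0)
    (Sum.elim (fun x => 1 - (Γ.partSize x : ℝ)⁻¹)
      fun t => bif t then ∑ x, (Γ.partSize x : ℝ)⁻¹ - 1 else 1)
    (fun k => by
      rw [← Matrix.IsHermitian.trace_pow_eq_sum_eigenvalues_pow, h.trace_lapMatrix_pow]
      simp [add_assoc]) f
  rw [this]
  simp [add_assoc]

end SimpleGraph

/-- The Laplacian energy of a complete multipartite graph with `n` vertices, in terms of the part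
sizes: the mean `2 e / n` of the Laplacian eigenvalues is `n - S / n`, where `S` is the sum over the
vertices of the sizes of their parts. -/
theorem laplacianEnergy_of_isCompleteMultipartite {V : Type*} [Fintype V] [Nonempty V]
    {Γ : SimpleGraph V} [DecidableRel Γ.Adj] (h : Γ.IsCompleteMultipartite) {n s : ℝ}
    (hn : (Fintype.card V : ℝ) = n) (hs : (∑ x, (Γ.partSize x : ℝ)) / n = s) :
    laplacianEnergy Γ = ∑ x, (1 - (Γ.partSize x : ℝ)⁻¹) * |s - Γ.partSize x| +
      (∑ x, (Γ.partSize x : ℝ)⁻¹ - 1) * |s| + |n - s| := by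
  classical
  have hn0 : n ≠ 0 := by rw [← hn]; exact_mod_cast Fintype.card_ne_zero
  have he : 2 * (Γ.edgeFinset.card : ℝ) / n = n - s := by
    have h1 : (2 * (Γ.edgeFinset.card : ℝ)) = ∑ x, (n - Γ.partSize x) := by
      have := Γ.sum_degrees_eq_twice_card_edges
      rw [show (2 * (Γ.edgeFinset.card : ℝ)) = ((2 * Γ.edgeFinset.card : ℕ) : ℝ) by push_cast; rfl,
        ← this]
      push_cast
      refine Finset.sum_congr rfl fun x _ => ?_
      rw [← hn, ← Γ.degree_add_partSize x]; push_cast; ring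
    rw [h1, Finset.sum_sub_distrib, Finset.sum_const, Finset.card_univ, nsmul_eq_mul, hn, ← hs]
    field_simp
  have key := h.sum_eigenvalues_lapMatrix fun μ => |μ - (n - s)|
  rw [hn] at key
  have h3 : laplacianEnergy Γ = ∑ i, |(Γ.isHermitian_lapMatrix ℝ).eigenvalues i - (n - s)| := by
    rw [← he, ← hn, laplacianEnergy]
    congr!
  rw [h3, key]
  rw [zero_sub, abs_neg, sub_sub_cancel]
  simp_rw [sub_sub_sub_cancel_left]

/-! ### Centralizers in `SL(2, F)` in characteristic two -/

/-- A matrix commuting with a non-scalar `2 × 2` matrix `A` lies in the algebra spanned by `1` and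
`A`. -/
theorem Matrix.exists_eq_smul_one_add_smul_of_commute {F : Type*} [Field F]
    {A B : Matrix (Fin 2) (Fin 2) F} (hA : ∀ c : F, A ≠ c • 1) (h : A * B = B * A) :
    ∃ a b : F, B = a • 1 + b • A := by
  have h00 := congrFun (congrFun h 0) 0
  have h01 := congrFun (congrFun h 0) 1
  have h10 := congrFun (congrFun h 1) 0
  simp only [Matrix.mul_apply, Fin.sum_univ_two] at h00 h01 h10
  have key : ∀ a b : F, B 0 0 = a + b * A 0 0 → B 0 1 = b * A 0 1 → B 1 0 = b * A 1 0 →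
      B 1 1 = a + b * A 1 1 → ∃ a b : F, B = a • 1 + b • A := by
    intro a b e1 e2 e3 e4
    refine ⟨a, b, ?_⟩
    ext i j
    fin_cases i <;> fin_cases j <;> simp [e1, e2, e3, e4]
  by_cases hy : A 0 1 = 0
  · by_cases hz : A 1 0 = 0
    · have hd : A 0 0 - A 1 1 ≠ 0 := by
        intro hd
        apply hA (A 0 0)
        ext i j
        fin_cases i <;> fin_cases j <;> simp [hy, hz, (sub_eq_zero.mp hd).symm]
      have e1 : B 0 1 = 0 := by
        apply (mul_eq_zero.mp _).resolve_left hd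
        rw [hy] at h01; linear_combination h01
      have e2 : B 1 0 = 0 := by
        apply (mul_eq_zero.mp _).resolve_left hd
        rw [hz] at h10; linear_combination -h10
      refine key (B 0 0 - (B 0 0 - B 1 1) / (A 0 0 - A 1 1) * A 0 0)
        ((B 0 0 - B 1 1) / (A 0 0 - A 1 1)) (by ring) (by rw [hy, e1, mul_zero])
        (by rw [hz, e2, mul_zero]) ?_
      field_simp
      ring
    · refine key (B 0 0 - B 1 0 / A 1 0 * A 0 0) (B 1 0 / A 1 0) (by ring) ?_ ?_ ?_
      · field_simp; linear_combination -h00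
      · field_simp
      · field_simp; linear_combination -h10
  · refine key (B 0 0 - B 0 1 / A 0 1 * A 0 0) (B 0 1 / A 0 1) (by ring) ?_ ?_ ?_
    · field_simp
    · field_simp; linear_combination h00
    · field_simp; linear_combination h01

namespace Matrix.SpecialLinearGroup

variable {F : Type*} [Field F]

section Counting

variable [Fintype F] [DecidableEq F]

/-- The number of roots of `u ^ 2 + t * u + 1`, the characteristic polynomial (in characteristic
two) of an element of `SL(2, F)` of trace `t`. -/
def numRoots (t : F) : ℕ := (Finset.univ.filter fun u : F => u ^ 2 + t * u + 1 = 0).card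

/-- Every `u ≠ 0` is a root for exactly one `t`, namely `t = u + u⁻¹`. -/
theorem sum_numRoots_add_one : ∑ t : F, numRoots t + 1 = Fintype.card F := by
  have h1 : ∑ t : F, numRoots t = (Finset.univ.filter fun u : F => u ≠ 0).card := by
    simp only [numRoots, Finset.card_filter]
    rw [Finset.sum_comm]
    refine Finset.sum_congr rfl fun u _ => ?_
    rw [← Finset.card_filter]
    split_ifs with hu
    · rw [Finset.card_eq_one]
      refine ⟨-(u ^ 2 + 1) / u, ?_⟩
      ext t
      simp only [Finset.mem_filter, Finset.mem_univ, true_and, Finset.mem_singleton]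
      rw [eq_div_iff hu]
      constructor <;> intro h <;> linear_combination h
    · simp [not_not.mp hu]
  rw [h1, Finset.filter_ne', Finset.card_erase_of_mem (Finset.mem_univ _), Finset.card_univ]
  exact Nat.sub_add_cancel Fintype.card_pos

theorem card_filter_mul_eq (c : F) :
    (Finset.univ.filter fun p : F × F => p.1 * p.2 = c).card + 1 =
      Fintype.card F + if c = 0 then Fintype.card F else 0 := by
  have key : ∀ x : F, (∑ y : F, if x * y = c then 1 else 0) + (if x = 0 then 1 else 0) =
      1 + if x = 0 then (if c = 0 then Fintype.card F else 0) else 0 := by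
    intro x
    rcases eq_or_ne x 0 with rfl | hx
    · rcases eq_or_ne c 0 with rfl | hc
      · simp [add_comm]
      · simp [hc, hc.symm]
    · simp [← eq_inv_mul_iff_mul_eq₀ hx, hx]
  have := Finset.sum_congr rfl fun (x : F) (_ : x ∈ Finset.univ) => key x
  rw [Finset.sum_add_distrib, Finset.sum_add_distrib] at this
  rw [Finset.card_filter, Fintype.sum_prod_type]
  simpa using this

end Counting

section CharTwo

variable [CharP F 2]

theorem sq_add_one_eq_zero_iff (u : F) : u ^ 2 + 1 = 0 ↔ u = 1 := by
  have : u ^ 2 + 1 = (u - 1) ^ 2 := by linear_combination u * CharTwo.two_eq_zero (R := F)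
  rw [this, pow_eq_zero_iff two_ne_zero, sub_eq_zero]

/-- In characteristic two the only scalar of determinant one is the identity, as `c ^ 2 = 1` forces
`c = 1`. -/
theorem coe_ne_smul_one_of_ne_one {A : SpecialLinearGroup (Fin 2) F} (hA : A ≠ 1) (c : F) :
    (A : Matrix (Fin 2) (Fin 2) F) ≠ c • 1 := by
  intro h
  apply hA
  have hd := A.det_coe
  rw [h, Matrix.det_smul, Matrix.det_one, mul_one, Fintype.card_fin] at hd
  have hc : c = 1 := by
    rw [← sub_eq_zero]
    apply pow_eq_zero_iff two_ne_zero |>.mp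
    linear_combination hd + (1 - c) * CharTwo.two_eq_zero (R := F)
  apply Subtype.ext
  rw [h, hc, one_smul]; rfl

theorem center_fin_two_eq_bot :
    Subgroup.center (SpecialLinearGroup (Fin 2) F) = ⊥ := by
  rw [eq_bot_iff]
  intro A hA
  by_contra h1
  obtain ⟨r, -, hr⟩ := mem_center_iff.mp hA
  refine coe_ne_smul_one_of_ne_one h1 r ?_
  rw [← hr, Matrix.smul_one_eq_diagonal]; rfl

/-- Commuting is transitive through a non-identity element, because its centralizer lies in the
commutative algebra that it generates. -/
theorem commute_trans_of_ne_one {A B C : SpecialLinearGroup (Fin 2) F} (hB : B ≠ 1)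
    (hAB : A * B = B * A) (hBC : B * C = C * B) : A * C = C * A := by
  obtain ⟨a, b, e1⟩ := Matrix.exists_eq_smul_one_add_smul_of_commute
    (coe_ne_smul_one_of_ne_one hB) (B := (A : Matrix (Fin 2) (Fin 2) F))
    (by simpa using congrArg Subtype.val hAB.symm)
  obtain ⟨c, d, e2⟩ := Matrix.exists_eq_smul_one_add_smul_of_commute
    (coe_ne_smul_one_of_ne_one hB) (B := (C : Matrix (Fin 2) (Fin 2) F))
    (by simpa using congrArg Subtype.val hBC)
  apply Subtype.ext
  rw [coe_mul, coe_mul, e1, e2]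
  simp only [add_mul, mul_add, smul_mul_assoc, mul_smul_comm, one_mul, mul_one]
  module

variable [Fintype F] [DecidableEq F]

theorem numRoots_zero : numRoots (0 : F) = 1 := by
  simp [numRoots, sq_add_one_eq_zero_iff, Finset.filter_eq']

theorem numRoots_eq_zero_or_two {t : F} (ht : t ≠ 0) : numRoots t = 0 ∨ numRoots t = 2 := by
  rw [or_iff_not_imp_left]
  intro h
  obtain ⟨r, hr⟩ := Finset.card_pos.mp (Nat.pos_of_ne_zero h)
  simp only [Finset.mem_filter, Finset.mem_univ, true_and] at hr
  -- the second root is `r + t`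
  have : (Finset.univ.filter fun u : F => u ^ 2 + t * u + 1 = 0) = {r, r + t} := by
    ext u
    simp only [Finset.mem_filter, Finset.mem_univ, true_and, Finset.mem_insert,
      Finset.mem_singleton]
    rw [← sub_eq_zero (a := u) (b := r), ← sub_eq_zero (a := u) (b := r + t), ← mul_eq_zero]
    have : (u - r) * (u - (r + t)) = u ^ 2 + t * u + 1 := by
      linear_combination hr + (-t * u - r * u - 1) * CharTwo.two_eq_zero (R := F)
    rw [this]
  rw [numRoots, this, Finset.card_pair]
  simpa using ht

/-- The number of points of the conic `a ^ 2 + t a b + b ^ 2 = 1`. -/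
theorem card_conic_add_numRoots (t : F) :
    (Finset.univ.filter fun p : F × F => p.1 ^ 2 + t * p.1 * p.2 + p.2 ^ 2 = 1).card + numRoots t =
      Fintype.card F + 1 := by
  have h2 := CharTwo.two_eq_zero (R := F)
  rcases eq_or_ne t 0 with rfl | ht
  · -- the conic is the double line `a + b = 1`
    rw [numRoots_zero, ← Finset.card_univ (α := F)]
    congr 1
    refine Finset.card_nbij' (fun p => p.2) (fun b => (1 + b, b)) (by simp) ?_ ?_ (fun _ _ => rfl)
    · intro b _
      simp only [Finset.coe_filter, Finset.mem_univ, true_and, Set.mem_ofPred_eq]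
      linear_combination (b + b ^ 2) * h2
    · rintro ⟨a, b⟩ hp
      simp only [Finset.coe_filter, Finset.mem_univ, true_and, Set.mem_ofPred_eq] at hp
      have : a + b = 1 := (sq_add_one_eq_zero_iff _).mp (by
        linear_combination hp + (1 + a * b) * h2)
      simp only [Prod.mk.injEq, and_true]
      linear_combination -this + b * h2
  · -- project from the point `(1, 0)`
    have e0 : (Finset.univ.filter fun p : F × F =>
        p.1 ^ 2 + t * p.1 * p.2 + p.2 ^ 2 = 1 ∧ p.2 = 0).card = 1 := by
      rw [Finset.card_eq_one]
      refine ⟨(1, 0), ?_⟩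
      ext ⟨a, b⟩
      simp only [Finset.mem_filter, Finset.mem_univ, true_and, Finset.mem_singleton,
        Prod.mk.injEq]
      constructor
      · rintro ⟨h, rfl⟩
        exact ⟨(sq_add_one_eq_zero_iff _).mp (by linear_combination h + h2), rfl⟩
      · rintro ⟨rfl, rfl⟩
        simp
    have e1 : (Finset.univ.filter fun p : F × F =>
        p.1 ^ 2 + t * p.1 * p.2 + p.2 ^ 2 = 1 ∧ ¬ p.2 = 0).card =
        (Finset.univ.filter fun u : F => ¬ u ^ 2 + t * u + 1 = 0).card := by
      refine Finset.card_nbij' (fun p => (p.1 - 1) / p.2)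
        (fun u => (1 + u * (t / (u ^ 2 + t * u + 1)), t / (u ^ 2 + t * u + 1))) ?_ ?_ ?_ ?_
      · rintro ⟨a, b⟩ hp
        simp only [Finset.coe_filter, Finset.mem_univ, true_and, Set.mem_ofPred_eq] at hp ⊢
        obtain ⟨hp, hb⟩ := hp
        intro h
        apply mul_ne_zero ht hb
        field_simp at h
        linear_combination -h + hp + (1 - a) * h2
      · intro u hu
        simp only [Finset.coe_filter, Finset.mem_univ, true_and, Set.mem_ofPred_eq] at hu ⊢
        refine ⟨?_, div_ne_zero ht hu⟩
        generalize hs : t / (u ^ 2 + t * u + 1) = s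
        rw [div_eq_iff hu] at hs
        linear_combination (u * s + s * t) * h2 - s * hs
      · rintro ⟨a, b⟩ hp
        simp only [Finset.coe_filter, Finset.mem_univ, true_and, Set.mem_ofPred_eq] at hp ⊢
        obtain ⟨hp, hb⟩ := hp
        have hQ : ((a - 1) / b) ^ 2 + t * ((a - 1) / b) + 1 = t / b := by
          field_simp
          linear_combination hp + (1 - a - t * b) * h2
        rw [hQ, div_div_cancel₀ ht, div_mul_cancel₀ _ hb, add_sub_cancel]
      · intro u hu
        simp only [Finset.coe_filter, Finset.mem_univ, true_and, Set.mem_ofPred_eq] at hu ⊢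
        rw [add_sub_cancel_left, mul_div_cancel_right₀ _ (div_ne_zero ht hu)]
    have e2 := Finset.card_filter_add_card_filter_not (s := Finset.univ.filter fun p : F × F =>
      p.1 ^ 2 + t * p.1 * p.2 + p.2 ^ 2 = 1) (fun p => p.2 = 0)
    have e3 := Finset.card_filter_add_card_filter_not (s := (Finset.univ : Finset F))
      (fun u => u ^ 2 + t * u + 1 = 0)
    rw [Finset.filter_filter, Finset.filter_filter, e0, e1] at e2
    rw [Finset.card_univ] at e3
    rw [← e2, ← e3, numRoots]
    ring

/-- The centralizer of `A ≠ 1` consists of the elements `a + b A` of determinant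
`a ^ 2 + a b tr A + b ^ 2 = 1`. -/
theorem natCard_centralizer_add_numRoots {A : SpecialLinearGroup (Fin 2) F} (hA : A ≠ 1) :
    Nat.card (Subgroup.centralizer {A}) + numRoots (A : Matrix (Fin 2) (Fin 2) F).trace =
      Fintype.card F + 1 := by
  rw [← card_conic_add_numRoots (A : Matrix (Fin 2) (Fin 2) F).trace]
  congr 1
  have hdet : ∀ a b : F, (a • 1 + b • (A : Matrix (Fin 2) (Fin 2) F)).det =
      a ^ 2 + (A : Matrix (Fin 2) (Fin 2) F).trace * a * b + b ^ 2 := by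
    intro a b
    have h := A.det_coe
    rw [Matrix.det_fin_two] at h
    simp [Matrix.det_fin_two, Matrix.trace_fin_two]
    linear_combination b ^ 2 * h
  rw [← Fintype.card_subtype, ← Nat.card_eq_fintype_card]
  let φ (p : {p : F × F //
      p.1 ^ 2 + (A : Matrix (Fin 2) (Fin 2) F).trace * p.1 * p.2 + p.2 ^ 2 = 1}) :
      SpecialLinearGroup (Fin 2) F :=
    ⟨p.1.1 • 1 + p.1.2 • (A : Matrix (Fin 2) (Fin 2) F), (hdet _ _).trans p.2⟩
  have hφ : ∀ p, φ p ∈ Subgroup.centralizer {A} := by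
    intro p
    rw [Subgroup.mem_centralizer_singleton_iff]
    apply Subtype.ext
    rw [coe_mul, coe_mul]
    simp [φ, add_mul, mul_add]
  symm
  refine Nat.card_congr (Equiv.ofBijective (fun p => ⟨φ p, hφ p⟩) ⟨?_, ?_⟩)
  · rintro ⟨⟨a, b⟩, hp⟩ ⟨⟨c, d⟩, hq⟩ h
    have h' : a • 1 + b • (A : Matrix (Fin 2) (Fin 2) F) = c • 1 + d • (A : Matrix _ _ F) :=
      congrArg (fun B => ((B.1 : SpecialLinearGroup (Fin 2) F) : Matrix (Fin 2) (Fin 2) F)) h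
    have hbd : b = d := by
      by_contra hbd
      have hbd' := sub_ne_zero.mpr hbd
      apply coe_ne_smul_one_of_ne_one hA ((c - a) / (b - d))
      rw [div_eq_inv_mul, mul_smul, eq_inv_smul_iff₀ hbd', sub_smul, sub_smul,
        sub_eq_sub_iff_add_eq_add, add_comm, h']
    subst hbd
    have hac : a = c := by
      have e := add_right_cancel h'
      simpa using congrFun (congrFun e 0) 0
    rw [Subtype.mk.injEq, hac]
  · rintro ⟨B, hB⟩
    rw [Subgroup.mem_centralizer_singleton_iff] at hB
    obtain ⟨a, b, e⟩ := Matrix.exists_eq_smul_one_add_smul_of_commute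
      (coe_ne_smul_one_of_ne_one hA) (B := (B : Matrix (Fin 2) (Fin 2) F))
      (by simpa using congrArg Subtype.val hB.symm)
    refine ⟨⟨(a, b), (hdet a b).symm.trans (e ▸ B.det_coe)⟩, ?_⟩
    apply Subtype.ext
    apply Subtype.ext
    exact e.symm

/-! ### The distribution of centralizer orders in `SL(2, F)` in characteristic two -/

/-- There are `q (q - 1 + r)` elements of trace `t`, where `r` is the number of roots of
`u ^ 2 + t * u + 1`: an entry `a` in the upper left corner leaves the off-diagonal entries subject
to `b c = a ^ 2 + t a + 1` only. -/
theorem card_filter_trace_eq (t : F) :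
    (Finset.univ.filter fun A : SpecialLinearGroup (Fin 2) F =>
      (A : Matrix (Fin 2) (Fin 2) F).trace = t).card + Fintype.card F =
      Fintype.card F * (Fintype.card F + numRoots t) := by
  have h2 := CharTwo.two_eq_zero (R := F)
  have fib : ∀ a : F, ((Finset.univ.filter fun A : SpecialLinearGroup (Fin 2) F =>
      (A : Matrix (Fin 2) (Fin 2) F).trace = t).filter fun A => A 0 0 = a).card =
      (Finset.univ.filter fun p : F × F => p.1 * p.2 = a ^ 2 + t * a + 1).card := by
    intro a
    refine Finset.card_bij (fun A _ => (A 0 1, A 1 0)) ?_ ?_ ?_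
    · intro A hA
      have hd := A.det_coe
      simp only [Finset.mem_filter, Finset.mem_univ, true_and, Matrix.trace_fin_two] at hA ⊢
      rw [Matrix.det_fin_two] at hd
      obtain ⟨rfl, rfl⟩ := hA
      linear_combination -hd - (A 0 0 ^ 2 + 1) * h2
    · intro A hA B hB hAB
      simp only [Finset.mem_filter, Finset.mem_univ, true_and, Matrix.trace_fin_two] at hA hB
      simp only [Prod.mk.injEq] at hAB
      have h11 : A 1 1 = B 1 1 := by linear_combination hA.1 - hB.1 - hA.2 + hB.2
      ext i j
      fin_cases i <;> fin_cases j
      · exact hA.2.trans hB.2.symm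
      · exact hAB.1
      · exact hAB.2
      · exact h11
    · rintro ⟨b, c⟩ hp
      simp only [Finset.mem_filter, Finset.mem_univ, true_and] at hp
      obtain ⟨A, h00, h01, h10, h11⟩ : ∃ A : SpecialLinearGroup (Fin 2) F,
          A 0 0 = a ∧ A 0 1 = b ∧ A 1 0 = c ∧ A 1 1 = t - a := by
        refine ⟨⟨!![a, b; c, t - a], ?_⟩, rfl, rfl, rfl, rfl⟩
        rw [Matrix.det_fin_two_of]
        linear_combination -hp - (a ^ 2 + 1) * h2
      refine ⟨A, ?_, by rw [h01, h10]⟩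
      simp only [Finset.mem_filter, Finset.mem_univ, Matrix.trace_fin_two, h00, h11,
        add_sub_cancel, and_self]
  rw [Finset.card_eq_sum_card_fiberwise (f := fun A => A 0 0) (t := Finset.univ)
    (fun _ _ => Finset.mem_coe.mpr (Finset.mem_univ _))]
  rw [Finset.sum_congr rfl fun a _ => fib a]
  have := Finset.sum_congr rfl fun (a : F) (_ : a ∈ Finset.univ) =>
    card_filter_mul_eq (a ^ 2 + t * a + 1)
  rw [Finset.sum_add_distrib, Finset.sum_add_distrib, ← Finset.sum_filter] at this
  simp only [Finset.sum_const, Finset.card_univ, smul_eq_mul, mul_one] at this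
  rw [this, numRoots]
  ring

/-- The distribution of the centralizer orders over the non-identity elements of `SL(2, q)`, for `q`
a power of two: they are `q`, `q - 1` and `q + 1`, for the elements whose characteristic polynomial
has one root, two roots and no root. -/
theorem sum_natCard_centralizer (g : ℕ → ℝ) {q : ℕ} (hq : Fintype.card F = q) :
    ∑ A ∈ Finset.univ.filter (fun A : SpecialLinearGroup (Fin 2) F => A ≠ 1),
      g (Nat.card (Subgroup.centralizer {A})) =
    ((q : ℝ) ^ 2 - 1) * g q + (q : ℝ) * (q + 1) * (q - 2) / 2 * g (q - 1) +
      (q : ℝ) ^ 2 * (q - 1) / 2 * g (q + 1) := by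
  set N : F → ℝ := fun t => ((Finset.univ.filter fun A : SpecialLinearGroup (Fin 2) F =>
      (A : Matrix (Fin 2) (Fin 2) F).trace = t).card : ℝ)
  have hN : ∀ t, N t = q * (q - 1 + numRoots t) := by
    intro t
    have h := card_filter_trace_eq t
    rw [hq] at h
    have h' : N t + q = q * (q + numRoots t) := by simp only [N]; exact_mod_cast h
    linear_combination h'
  have hcen : ∀ A : SpecialLinearGroup (Fin 2) F, A ≠ 1 →
      g (Nat.card (Subgroup.centralizer {A})) =
        g (q + 1 - numRoots (A : Matrix (Fin 2) (Fin 2) F).trace) := by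
    intro A hA
    have h := natCard_centralizer_add_numRoots hA
    rw [hq] at h
    congr 1
    omega
  -- the identity has trace `0`
  have htr : ((1 : SpecialLinearGroup (Fin 2) F) : Matrix (Fin 2) (Fin 2) F).trace = 0 := by
    rw [Matrix.SpecialLinearGroup.coe_one, Matrix.trace_one, Fintype.card_fin]
    exact_mod_cast CharTwo.two_eq_zero
  have hall : ∑ A : SpecialLinearGroup (Fin 2) F,
      g (q + 1 - numRoots (A : Matrix (Fin 2) (Fin 2) F).trace) =
      ∑ t : F, N t * g (q + 1 - numRoots t) := by
    rw [← Finset.sum_fiberwise_of_maps_to (s := Finset.univ) (t := Finset.univ)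
      (g := fun A : SpecialLinearGroup (Fin 2) F => (A : Matrix (Fin 2) (Fin 2) F).trace)
      (fun _ _ => Finset.mem_univ _)]
    refine Finset.sum_congr rfl fun t _ => ?_
    rw [Finset.sum_congr rfl (g := fun _ => g (q + 1 - numRoots t)), Finset.sum_const,
      nsmul_eq_mul]
    intro A hA
    rw [(Finset.mem_filter.mp hA).2]
  have hsplit := Finset.add_sum_erase (Finset.univ : Finset (SpecialLinearGroup (Fin 2) F))
    (fun A => g (q + 1 - numRoots (A : Matrix (Fin 2) (Fin 2) F).trace)) (Finset.mem_univ 1)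
  have hsplit2 := Finset.add_sum_erase (Finset.univ : Finset F)
    (fun t => N t * g (q + 1 - numRoots t)) (Finset.mem_univ 0)
  have hroots := Finset.add_sum_erase (Finset.univ : Finset F)
    (fun t => (numRoots t : ℝ)) (Finset.mem_univ 0)
  have hsum : ∑ t : F, (numRoots t : ℝ) + 1 = q := by
    rw [← hq]; exact_mod_cast sum_numRoots_add_one (F := F)
  -- away from `0` the number of roots is `0` or `2`, so the summand is affine in it
  have hlin : ∀ t ∈ (Finset.univ : Finset F).erase 0, N t * g (q + 1 - numRoots t) =
      q * (q - 1) * g (q + 1) +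
        numRoots t * ((q * (q + 1) * g (q - 1) - q * (q - 1) * g (q + 1)) / 2) := by
    intro t ht
    rw [hN]
    rcases numRoots_eq_zero_or_two (Finset.ne_of_mem_erase ht) with h | h <;> rw [h]
    · simp
    · rw [show q + 1 - 2 = q - 1 by omega]
      push_cast
      ring
  rw [Finset.sum_congr rfl hlin, Finset.sum_add_distrib, Finset.sum_const, ← Finset.sum_mul,
    Finset.card_erase_of_mem (Finset.mem_univ _), Finset.card_univ, hq, nsmul_eq_mul,
    Nat.cast_sub (hq ▸ Fintype.card_pos), hN, numRoots_zero, Nat.add_sub_cancel] at hsplit2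
  rw [htr, numRoots_zero, Nat.add_sub_cancel, hall, ← hsplit2] at hsplit
  rw [numRoots_zero] at hroots
  push_cast at hroots hsplit
  rw [Finset.filter_ne', Finset.sum_congr rfl fun A hA => hcen A (Finset.ne_of_mem_erase hA)]
  linear_combination hsplit + ((q * (q + 1) * g (q - 1) - q * (q - 1) * g (q + 1)) / 2) *
    (hroots + hsum)

end CharTwo

end Matrix.SpecialLinearGroup

/-! ### The non-commuting graph of `PSL(2, 2 ^ k)` -/

section NonCommutingGraph

variable {G H : Type*} [Group G] [Group H]

theorem nonCommutingGraph_not_adj_iff (e : G ≃* H) (x y : {x : G // x ∉ Subgroup.center G}) :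
    ¬ (nonCommutingGraph G).Adj x y ↔ e x * e y = e y * e x := by
  rw [← map_mul, ← map_mul, e.injective.eq_iff]
  exact not_not

theorem nonCommutingGraph_isCompleteMultipartite (e : G ≃* H)
    (h : ∀ x y z : H, y ≠ 1 → x * y = y * x → y * z = z * y → x * z = z * x) :
    (nonCommutingGraph G).IsCompleteMultipartite := by
  refine ⟨fun x y z hxy hyz => ?_⟩
  rw [nonCommutingGraph_not_adj_iff e] at hxy hyz ⊢
  refine h _ _ _ (fun h1 => y.2 ?_) hxy hyz
  rw [(map_eq_one_iff e e.injective).mp h1]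
  exact one_mem _

theorem mem_center_iff_of_mulEquiv (e : G ≃* H) (hH : Subgroup.center H = ⊥) (x : G) :
    x ∈ Subgroup.center G ↔ e x = 1 := by
  rw [← Subgroup.mem_bot, ← hH]
  simp only [Subgroup.mem_center_iff]
  constructor
  · intro h y
    obtain ⟨y, rfl⟩ := e.surjective y
    rw [← map_mul, h, map_mul]
  · intro h y
    apply e.injective
    rw [map_mul, h, map_mul]

/-- In a group with trivial center the non-neighbours of `x` are the non-identity elements of its
centralizer. -/
theorem partSize_nonCommutingGraph_add_one [Finite G] [Fintype {x : G // x ∉ Subgroup.center G}]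
    [DecidableRel (nonCommutingGraph G).Adj] (e : G ≃* H) (hH : Subgroup.center H = ⊥)
    (x : {x : G // x ∉ Subgroup.center G}) :
    (nonCommutingGraph G).partSize x + 1 = Nat.card (Subgroup.centralizer {e x}) := by
  have := Finite.of_equiv G e.toEquiv
  have h1 : (nonCommutingGraph G).partSize x =
      Nat.card {z : Subgroup.centralizer {e (x : G)} // z ≠ 1} := by
    rw [SimpleGraph.partSize, ← Fintype.card_subtype, ← Nat.card_eq_fintype_card]
    refine Nat.card_congr (Equiv.ofBijective (fun y => ⟨⟨e y.1, ?_⟩, ?_⟩) ⟨?_, ?_⟩)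
    · rw [Subgroup.mem_centralizer_singleton_iff]
      exact ((nonCommutingGraph_not_adj_iff e _ _).mp y.2).symm
    · intro h
      exact y.1.2 ((mem_center_iff_of_mulEquiv e hH _).mpr (congrArg Subtype.val h))
    · intro y z h
      apply Subtype.ext
      apply Subtype.ext
      exact e.injective (congrArg (fun w => (w.1 : H)) h)
    · rintro ⟨⟨z, hz⟩, hz1⟩
      obtain ⟨y, rfl⟩ := e.surjective z
      rw [Subgroup.mem_centralizer_singleton_iff] at hz
      exact ⟨⟨⟨y, fun hy => hz1 (Subtype.ext ((mem_center_iff_of_mulEquiv e hH _).mp hy))⟩,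
        (nonCommutingGraph_not_adj_iff e _ _).mpr hz.symm⟩, rfl⟩
  have := Fintype.ofFinite (Subgroup.centralizer {e (x : G)})
  classical
  rw [h1, Nat.card_eq_fintype_card, Nat.card_eq_fintype_card, Fintype.card_subtype_compl,
    Fintype.card_subtype_eq]
  exact Nat.sub_add_cancel Fintype.card_pos

theorem sum_partSize_nonCommutingGraph [Finite G] [Fintype {x : G // x ∉ Subgroup.center G}]
    [DecidableRel (nonCommutingGraph G).Adj] [Fintype H] [DecidableEq H] (e : G ≃* H)
    (hH : Subgroup.center H = ⊥) (g : ℕ → ℝ) :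
    ∑ x, g ((nonCommutingGraph G).partSize x) =
      ∑ y ∈ Finset.univ.filter (fun y : H => y ≠ 1),
        g (Nat.card (Subgroup.centralizer {y}) - 1) := by
  refine Finset.sum_bij (fun x _ => e x) ?_ ?_ ?_ ?_
  · intro x _
    simpa [mem_center_iff_of_mulEquiv e hH] using x.2
  · intro x _ y _ h
    exact Subtype.ext (e.injective h)
  · intro y hy
    obtain ⟨x, rfl⟩ := e.surjective y
    refine ⟨⟨x, ?_⟩, Finset.mem_univ _, rfl⟩
    rw [mem_center_iff_of_mulEquiv e hH]
    simpa using hy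
  · intro x _
    rw [← partSize_nonCommutingGraph_add_one e hH, Nat.add_sub_cancel]

end NonCommutingGraph

/-- The Laplacian energy of the non-commuting graph of any group isomorphic to `SL(2, q)`, for `q`
a power of two. -/
theorem laplacianEnergy_nonCommutingGraph_of_mulEquiv {G F : Type*} [Group G] [Finite G] [Field F]
    [Fintype F] [CharP F 2] (e : G ≃* Matrix.SpecialLinearGroup (Fin 2) F) {q : ℕ}
    (hq : Fintype.card F = q) (hq4 : 4 ≤ q) :
    laplacianEnergy (nonCommutingGraph G) =
      (3 * (q : ℝ) ^ 6 - 2 * q ^ 5 - 7 * q ^ 4 + q ^ 3 + 4 * q ^ 2 + q) / (q ^ 3 - q - 1) := by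
  classical
  have := Fintype.ofFinite {x : G // x ∉ Subgroup.center G}
  set Γ := nonCommutingGraph G
  have hsum : ∀ g : ℕ → ℝ, ∑ x, g (Γ.partSize x) =
      ((q : ℝ) ^ 2 - 1) * g (q - 1) + (q : ℝ) * (q + 1) * (q - 2) / 2 * g (q - 2) +
        (q : ℝ) ^ 2 * (q - 1) / 2 * g q := by
    intro g
    rw [sum_partSize_nonCommutingGraph e Matrix.SpecialLinearGroup.center_fin_two_eq_bot,
      Matrix.SpecialLinearGroup.sum_natCard_centralizer (fun j => g (j - 1)) hq]
    rfl
  have c1 : ((q - 1 : ℕ) : ℝ) = q - 1 := by rw [Nat.cast_sub (by omega)]; norm_num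
  have c2 : ((q - 2 : ℕ) : ℝ) = q - 2 := by rw [Nat.cast_sub (by omega)]; norm_num
  have hq4' : (4 : ℝ) ≤ q := by exact_mod_cast hq4
  -- the number of vertices
  obtain ⟨n, hn⟩ : ∃ n : ℝ, n = (q : ℝ) ^ 3 - q - 1 := ⟨_, rfl⟩
  have hqn : (q : ℝ) < n := by
    have h16 : (16 : ℝ) ≤ (q : ℝ) ^ 2 := by nlinarith
    nlinarith
  have hn0 : 0 < n := by linarith
  have hcard : (Fintype.card {x : G // x ∉ Subgroup.center G} : ℝ) = n := by
    have h := hsum fun _ => 1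
    rw [Finset.sum_const, Finset.card_univ, nsmul_eq_mul, mul_one] at h
    rw [h, hn]
    ring
  have hne : Nonempty {x : G // x ∉ Subgroup.center G} := by
    rw [← Fintype.card_pos_iff]
    exact_mod_cast hcard ▸ hn0
  have hs : (∑ x, (Γ.partSize x : ℝ)) / n = q - 1 + q / n := by
    rw [hsum fun m => (m : ℝ), c1, c2]
    field_simp
    rw [hn]
    ring
  have hqn1 : (q : ℝ) / n < 1 := (div_lt_one hn0).mpr hqn
  have hqn0 : 0 < (q : ℝ) / n := by positivity
  -- the mean eigenvalue is `n - s` with `q - 2 < q - 1 < s = q - 1 + q / n < q`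
  rw [laplacianEnergy_of_isCompleteMultipartite (nonCommutingGraph_isCompleteMultipartite e
      fun _ _ _ => Matrix.SpecialLinearGroup.commute_trans_of_ne_one) hcard hs,
    hsum fun m => (1 - (m : ℝ)⁻¹) * |q - 1 + q / n - m|, hsum fun m => (m : ℝ)⁻¹, c1, c2,
    abs_of_pos (show 0 < (q : ℝ) - 1 + q / n - (q - 1) by linarith),
    abs_of_pos (show 0 < (q : ℝ) - 1 + q / n - (q - 2) by linarith),
    abs_of_neg (show (q : ℝ) - 1 + q / n - q < 0 by linarith),
    abs_of_pos (show 0 < (q : ℝ) - 1 + q / n by linarith),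
    abs_of_pos (show 0 < n - ((q : ℝ) - 1 + q / n) by linarith), ← hn]
  have h0 : (q : ℝ) ≠ 0 := by linarith
  have h1 : (q : ℝ) - 1 ≠ 0 := by linarith
  have h2 : (q : ℝ) - 2 ≠ 0 := by linarith
  field_simp
  rw [hn]
  ring

theorem mainTheorem9 (k : ℕ) (hk : 2 ≤ k) (F : Type*) [Field F] [Finite F]
    (hF : Nat.card F = 2 ^ k) :
    laplacianEnergy (nonCommutingGraph (Matrix.ProjectiveSpecialLinearGroup (Fin 2) F)) =
      (3 * (2 : ℝ) ^ (6 * k) - 2 * 2 ^ (5 * k) - 7 * 2 ^ (4 * k) + 2 ^ (3 * k) + 4 * 2 ^ (2 * k)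
        + 2 ^ k) / (2 ^ (3 * k) - 2 ^ k - 1) := by
  have := Fintype.ofFinite F
  rw [Nat.card_eq_fintype_card] at hF
  have : CharP F 2 := charP_of_card_eq_prime_pow hF
  have h4 : 4 ≤ 2 ^ k := Nat.pow_le_pow_right (n := 2) two_pos hk
  -- the center is trivial, so the quotient map is an isomorphism
  rw [laplacianEnergy_nonCommutingGraph_of_mulEquiv (F := F)
    ((QuotientGroup.quotientMulEquivOfEq
      Matrix.SpecialLinearGroup.center_fin_two_eq_bot).trans QuotientGroup.quotientBot) hF h4]
  push_cast
  simp only [← pow_mul, mul_comm k]
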